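/- Let $K$ be a field, $P=K[x_1,\dots,x_n]$, let $W=(w_1,\dots,w_n)$ be a row of positive integers, and grade $P$ by $\deg_W(x_i)=w_i$. Let $I\subset P$ be a zero-dimensional ideal, i.e. a proper ideal with $\dim_K(P/I)<\infty$. Let $\mathcal O=\{t_1,\dots,t_\mu\}$ be an order ideal, i.e. a finite set of terms (power products) containing all divisors of its elements, with border $\partial\mathcal O=(x_1\mathcal O\cup\dots\cup x_n\mathcal O)\setminus\mathcal O=\{b_1,\dots,b_\nu\}$. An $\mathcal O$-border basis of an ideal $J\subseteq P$ is a set $\{g_1,\dots,g_\nu\}\subseteq J$ of polynomials of the form $g_j=b_j-\sum_{i=1}^\mu a_{ij}t_i$ with $a_{ij}\in K$, where in addition $P=J\oplus\langle\mathcal O\rangle_K$. For $f\in P\setminus\{0\}$ let $\mathrm{DF}_W(f)$ be its homogeneous component of highest $W$-degree, and let $\mathrm{DF}_W(I)$ be the ideal generated by all $\mathrm{DF}_W(f)$ with $f\in I\setminus\{0\}$. Let $\overline P=K[x_0,x_1,\dots,x_n]$. For $f=\sum_u c_u u\in P\setminus\{0\}$ (a sum over terms $u$) let $f^{\mathrm{hom}}=\sum_{c_u\neq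 0} c_u\,x_0^{\deg_W(f)-\deg_W(u)}\,u\in\overline P$, and let $I^{\mathrm{hom}}\subseteq\overline P$ be the ideal generated by all $f^{\mathrm{hom}}$ with $f\in I\setminus\{0\}$. Then the following conditions are equivalent. (a) The ideal $I$ has an $\mathcal O$-border basis $G=\{g_1,\dots,g_\nu\}$ such that $b_j\in\mathrm{Supp}(\mathrm{DF}_W(g_j))$ for $j=1,\dots,\nu$. (b) The ideal $\mathrm{DF}_W(I)$ has an $\mathcal O$-border basis. If these conditions are satisfied and $G=\{g_1,\dots,g_\nu\}$ is the $\mathcal O$-border basis of $I$, then $\{\mathrm{DF}_W(g_1),\dots,\mathrm{DF}_W(g_\nu)\}$ is the unique $\mathcal O$-border basis of $\mathrm{DF}_W(I)$, and $$I=(g_1,\dots,g_\nu),\qquad \mathrm{DF}_W(I)=(\mathrm{DF}_W(g_1),\dots,\mathrm{DF}_W(g_\nu)).$$ Moreover, the canonical homomorphism $K[x_0]\to\overline P/I^{\mathrm{hom}}$ is flat, and it makes $\overline P/I^{\mathrm{hom}}$ a free $K[x_0]$-module. Its general fibers are isomorphic to $P/I$ and its special fiber is isomorphic to $P/\mathrm{DF}_W(I)$: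 there are isomorphisms of $K$-algebras $$\overline P/(I^{\mathrm{hom}}+(x_0-c))\cong P/I\quad\text{for every } c\in K\setminus\{0\},\qquad \overline P/(I^{\mathrm{hom}}+(x_0))\cong P/\mathrm{DF}_W(I).$$ -/

import Mathlib

open MvPolynomial

noncomputable section

namespace BorderBasis

variable {n : ℕ} {K : Type*} [Field K]

/-- An order ideal: a finite set of terms (given by their exponent vectors) which contains all
divisors of its elements.  The term with exponent `s` divides the one with exponent `t` iff
`s ≤ t`. -/
def IsOrderIdeal (O : Finset (Fin n →₀ ℕ)) : Prop :=
  ∀ t ∈ O, ∀ s : Fin n →₀ ℕ, s ≤ t → s ∈ O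

/-- The border `∂O = (x₁ O ∪ ⋯ ∪ xₙ O) \ O`. -/
def border (O : Finset (Fin n →₀ ℕ)) : Finset (Fin n →₀ ℕ) :=
  (Finset.univ.biUnion fun i : Fin n => O.image fun t => t + Finsupp.single i 1) \ O

/-- The `K`-vector space `⟨O⟩_K` spanned by the terms in `O`. -/
def termSpan (K : Type*) [Field K] (O : Finset (Fin n →₀ ℕ)) :
    Submodule K (MvPolynomial (Fin n) K) :=
  Submodule.span K ((fun t => monomial t (1 : K)) '' (O : Set (Fin n →₀ ℕ)))

/-- A family `g`, indexed by the border terms, is an `O`-border prebasis of `I` if every `g b`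
lies in `I` and has the form `b - ∑ t ∈ O, a_{t b} t` with `a_{t b} ∈ K`. -/
def IsBorderPrebasis (O : Finset (Fin n →₀ ℕ)) (g : border O → MvPolynomial (Fin n) K)
    (I : Ideal (MvPolynomial (Fin n) K)) : Prop :=
  ∀ b : border O, g b ∈ I ∧
    ∃ a : (Fin n →₀ ℕ) → K, g b = monomial b.1 1 - ∑ t ∈ O, monomial t (a t)

/-- An `O`-border basis of `I` is an `O`-border prebasis of `I` such that `P = I ⊕ ⟨O⟩_K`. -/
def IsBorderBasis (O : Finset (Fin n →₀ ℕ)) (g : border O → MvPolynomial (Fin n) K)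
    (I : Ideal (MvPolynomial (Fin n) K)) : Prop :=
  IsBorderPrebasis O g I ∧ IsCompl (I.restrictScalars K) (termSpan K O)

/-- A zero-dimensional ideal: a proper ideal of finite `K`-codimension. -/
def IsZeroDimensional (I : Ideal (MvPolynomial (Fin n) K)) : Prop :=
  I ≠ ⊤ ∧ Module.Finite K (MvPolynomial (Fin n) K ⧸ I)

/-- The degree form `DF_W(f)`: the homogeneous component of `f` of highest `W`-degree. -/
def degreeForm (W : Fin n → ℕ) (f : MvPolynomial (Fin n) K) : MvPolynomial (Fin n) K :=
  weightedHomogeneousComponent W (weightedTotalDegree W f) f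

/-- The degree form ideal `DF_W(I)`, generated by all `DF_W(f)` with `f ∈ I \ {0}`. -/
def degreeFormIdeal (W : Fin n → ℕ) (I : Ideal (MvPolynomial (Fin n) K)) :
    Ideal (MvPolynomial (Fin n) K) :=
  Ideal.span {h | ∃ f ∈ I, f ≠ 0 ∧ h = degreeForm W f}

/-- The homogenization `f^hom` in `K[x₀, x₁, …, xₙ]` with respect to the weights
`(1, w₁, …, wₙ)`: each term `c u` of `f` is multiplied by `x₀ ^ (deg_W f - deg_W u)`.
Here `x₀ = X 0`, and the indeterminate `xᵢ` of `P` becomes `X i.succ`. -/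
def homogenization (W : Fin n → ℕ) (f : MvPolynomial (Fin n) K) :
    MvPolynomial (Fin (n + 1)) K :=
  ∑ d ∈ f.support, X 0 ^ (weightedTotalDegree W f - Finsupp.weight W d) *
    rename Fin.succ (monomial d (coeff d f))

/-- The homogenization `I^hom`, generated by all `f^hom` with `f ∈ I`. -/
def homIdeal (W : Fin n → ℕ) (I : Ideal (MvPolynomial (Fin n) K)) :
    Ideal (MvPolynomial (Fin (n + 1)) K) :=
  Ideal.span {h | ∃ f ∈ I, h = homogenization W f}

/-- The canonical homomorphism `K[x₀] → K[x₀, …, xₙ] / I^hom`. -/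
def deformation (W : Fin n → ℕ) (I : Ideal (MvPolynomial (Fin n) K)) :
    Polynomial K →ₐ[K] MvPolynomial (Fin (n + 1)) K ⧸ homIdeal W I :=
  (Ideal.Quotient.mkₐ K (homIdeal W I)).comp (Polynomial.aeval (X 0))

/-- The fiber `K[x₀, …, xₙ] / (I^hom + (x₀ - c))` of the family over `x₀ = c`. -/
abbrev Fiber (W : Fin n → ℕ) (I : Ideal (MvPolynomial (Fin n) K)) (c : K) : Type _ :=
  MvPolynomial (Fin (n + 1)) K ⧸
    (homIdeal W I ⊔ Ideal.span {(X 0 - C c : MvPolynomial (Fin (n + 1)) K)})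

/-- The target of the ring homomorphism `φ` is free as a module over the source. -/
def IsFreeHom {R S : Type*} [CommRing R] [CommRing S] (φ : R →+* S) : Prop :=
  letI := φ.toModule
  Module.Free R S

end BorderBasis

end

/-!
Let `⟨O⟩` be the span of the terms of `O`.  Everything rests on the notion `IsFilteredComplement`:
`I ∩ ⟨O⟩ = 0`, and every polynomial is congruent modulo `I` to an element of `⟨O⟩` of no larger
`W`-degree.

Both conditions of the equivalence say that `⟨O⟩` is a filtered complement of `I`.  If the border
basis elements `g b` have `b` in their degree form, then rewriting border terms never raises
degrees (`IsBorderBasis.isFilteredComplement`).  Every homogeneous element of `DF_W(I)` is the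
leading part of an element of `I` (`exists_weightedHomogeneousComponent_eq`); hence taking leading
parts turns a filtered complement of `I` into a complement of `DF_W(I)`
(`IsFilteredComplement.isCompl_degreeFormIdeal`), and induction on the degree gives the converse
(`isFilteredComplement_of_isCompl`).  Conversely, when `⟨O⟩` meets `DF_W(I)` trivially, the degree
form of `g b` cannot lie in `⟨O⟩`, so it contains `b`; thus the degree forms are a border basis of
`DF_W(I)`.  A border basis generates its ideal, because any ideal containing it spans `P` together
with `⟨O⟩`.

For the deformation, the terms of `O` are a basis of `K[x₀, …, xₙ] / I^hom` over `K[x₀]`.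
They span since a congruence `u ≡ v` modulo `I` with `deg v ≤ deg u` can be homogenized in degree
`deg u`.  They are independent since the substitution `x₀ ↦ X`, `xᵢ ↦ X ^ wᵢ xᵢ` carries `f^hom` to
`X ^ deg f * f`, hence `I^hom` into `I[X]`, which meets `⟨O⟩[X]` trivially.  The fibers are
identified for arbitrary `I` by explicit mutually inverse maps: for `c ≠ 0` the rescaling
`xᵢ ↦ c ^ wᵢ xᵢ` sends `f^hom` at `x₀ = c` to `c ^ deg f * f`, and at `x₀ = 0` the polynomial
`f^hom` becomes `DF_W(f)`.
-/

namespace BorderBasis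

variable {n : ℕ} {K : Type*} [Field K] {W : Fin n → ℕ} {O : Finset (Fin n →₀ ℕ)}
  {I J : Ideal (MvPolynomial (Fin n) K)}

/-! ### Polynomials with prescribed support and border prebases -/

lemma mem_restrictSupport_iff_coeff {s : Set (Fin n →₀ ℕ)} {p : MvPolynomial (Fin n) K} :
    p ∈ restrictSupport K s ↔ ∀ u, coeff u p ≠ 0 → u ∈ s := by
  simp [mem_restrictSupport_iff, Set.subset_def]

lemma mem_sup_restrictSupport_mono {s t : Set (Fin n →₀ ℕ)}
    {p : MvPolynomial (Fin n) K} (hp : p ∈ I.restrictScalars K ⊔ restrictSupport K s)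
    (h : s ⊆ t) :
    p ∈ I.restrictScalars K ⊔ restrictSupport K t :=
  sup_le_sup_left (restrictSupport_mono K h) _ hp

lemma termSpan_eq_restrictSupport (O : Finset (Fin n →₀ ℕ)) :
    termSpan K O = restrictSupport K (O : Set (Fin n →₀ ℕ)) :=
  (restrictSupport_eq_span K _).symm

lemma notMem_of_mem_border {b : Fin n →₀ ℕ} (hb : b ∈ border O) : b ∉ O :=
  (Finset.mem_sdiff.1 hb).2

lemma add_single_mem_or_mem_border {t : Fin n →₀ ℕ} (ht : t ∈ O) (i : Fin n) :
    t + Finsupp.single i 1 ∈ O ∨ t + Finsupp.single i 1 ∈ border O := by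
  by_cases h : t + Finsupp.single i 1 ∈ O
  · exact Or.inl h
  · refine Or.inr (Finset.mem_sdiff.2 ⟨?_, h⟩)
    exact Finset.mem_biUnion.2 ⟨i, Finset.mem_univ i, Finset.mem_image_of_mem _ ht⟩

lemma eq_sum_of_mem_restrictSupport {p : MvPolynomial (Fin n) K}
    (hp : p ∈ restrictSupport K (O : Set (Fin n →₀ ℕ))) :
    p = ∑ t ∈ O, monomial t (coeff t p) := by
  have hsub : p.support ⊆ O := fun t ht => hp ht
  refine (support_sum_monomial_coeff p).symm.trans (Finset.sum_subset hsub fun t _ ht => ?_)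
  rw [notMem_support_iff.1 ht, map_zero]

lemma isBorderPrebasis_iff {g : border O → MvPolynomial (Fin n) K} :
    IsBorderPrebasis O g I ↔ ∀ b, g b ∈ I ∧
      monomial b.1 1 - g b ∈ restrictSupport K (O : Set (Fin n →₀ ℕ)) := by
  refine forall_congr' fun b => and_congr_right fun _ => ⟨?_, fun h => ?_⟩
  · rintro ⟨a, ha⟩
    rw [ha, sub_sub_cancel]
    exact Submodule.sum_mem _ fun t ht => (monomial_mem_restrictSupport K).2 (Or.inl ht)
  · refine ⟨fun t => coeff t (monomial b.1 1 - g b), ?_⟩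
    rw [← eq_sum_of_mem_restrictSupport h, sub_sub_cancel]

lemma IsBorderPrebasis.coeff_self {g : border O → MvPolynomial (Fin n) K}
    (hg : IsBorderPrebasis O g I) (b : border O) : coeff b.1 (g b) = 1 := by
  have h := mt (mem_restrictSupport_iff_coeff.1 (isBorderPrebasis_iff.1 hg b).2 b.1)
    (notMem_of_mem_border b.2)
  rw [not_not, coeff_sub, coeff_monomial, if_pos rfl, sub_eq_zero] at h
  exact h.symm

lemma IsBorderPrebasis.mem_of_coeff_ne_zero {g : border O → MvPolynomial (Fin n) K}
    (hg : IsBorderPrebasis O g I) (b : border O) {u : Fin n →₀ ℕ} (hu : coeff u (g b) ≠ 0)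
    (hub : u ≠ b.1) : u ∈ O := by
  refine mem_restrictSupport_iff_coeff.1 (isBorderPrebasis_iff.1 hg b).2 u ?_
  rwa [coeff_sub, coeff_monomial, if_neg hub.symm, zero_sub, neg_ne_zero]

lemma exists_isBorderBasis_iff :
    (∃ g : border O → MvPolynomial (Fin n) K, IsBorderBasis O g I) ↔
      IsCompl (I.restrictScalars K) (restrictSupport K (O : Set (Fin n →₀ ℕ))) := by
  rw [← termSpan_eq_restrictSupport]
  refine ⟨fun ⟨g, hg⟩ => hg.2, fun h => ?_⟩
  have key : ∀ b : border O, ∃ f ∈ I, monomial b.1 1 - f ∈ termSpan K O := fun b => by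
    obtain ⟨f, hf, v, hv, hfv⟩ := Submodule.mem_sup.1
      (h.sup_eq_top ▸ Submodule.mem_top :
        monomial b.1 (1 : K) ∈ I.restrictScalars K ⊔ termSpan K O)
    exact ⟨f, hf, by rwa [← hfv, add_sub_cancel_left]⟩
  choose g hg hg' using key
  refine ⟨g, isBorderPrebasis_iff.2 fun b => ⟨hg b, ?_⟩, h⟩
  rw [← termSpan_eq_restrictSupport]
  exact hg' b

lemma IsBorderBasis.unique {g h : border O → MvPolynomial (Fin n) K} (hg : IsBorderBasis O g I)
    (hh : IsBorderBasis O h I) : h = g := by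
  funext b
  have hg' := isBorderPrebasis_iff.1 hg.1 b
  have hh' := isBorderPrebasis_iff.1 hh.1 b
  refine sub_eq_zero.1 (Submodule.disjoint_def.1 hg.2.disjoint _ (I.sub_mem hh'.1 hg'.1) ?_)
  rw [termSpan_eq_restrictSupport, ← sub_sub_sub_cancel_left]
  exact Submodule.sub_mem _ hg'.2 hh'.2

lemma IsOrderIdeal.zero_mem (hO : IsOrderIdeal O) (hI : I ≠ ⊤)
    (h : IsCompl (I.restrictScalars K) (restrictSupport K (O : Set (Fin n →₀ ℕ)))) :
    (0 : Fin n →₀ ℕ) ∈ O := by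
  by_contra h0
  have hempty : O = ∅ := Finset.eq_empty_of_forall_notMem fun t ht => h0 (hO t ht 0 zero_le)
  have htop := h.sup_eq_top
  rw [hempty, Finset.coe_empty, restrictSupport_eq_span, Set.image_empty, Submodule.span_empty,
    sup_bot_eq, Submodule.restrictScalars_eq_top_iff] at htop
  exact hI htop

/-- Rewriting border terms does not raise degrees, provided that no border term needs a term of
`O` of larger degree.  For `W = 0` the degree bounds are void. -/
lemma monomial_mem_sup_of_border (h0 : (0 : Fin n →₀ ℕ) ∈ O)
    (hb : ∀ b ∈ border O, monomial b (1 : K) ∈ J.restrictScalars K ⊔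
      restrictSupport K {t | t ∈ O ∧ Finsupp.weight W t ≤ Finsupp.weight W b})
    (u : Fin n →₀ ℕ) : monomial u (1 : K) ∈ J.restrictScalars K ⊔
      restrictSupport K {t | t ∈ O ∧ Finsupp.weight W t ≤ Finsupp.weight W u} := by
  induction u using WellFoundedLT.induction with
  | ind u ih =>
  rcases eq_or_ne u 0 with rfl | hu
  · exact Submodule.mem_sup_right ((monomial_mem_restrictSupport K).2 (Or.inl ⟨h0, le_rfl⟩))
  obtain ⟨i, hi⟩ := Finsupp.ne_iff.1 hu
  have hle : Finsupp.single i 1 ≤ u := Finsupp.single_le_iff.2 (Nat.one_le_iff_ne_zero.2 hi)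
  obtain ⟨s, rfl⟩ := exists_add_of_le hle
  rw [add_comm (Finsupp.single i 1)]
  have hlt : s < Finsupp.single i 1 + s := lt_add_of_pos_left s (by
    rw [pos_iff_ne_zero]; simp)
  have key : (J.restrictScalars K ⊔ restrictSupport K
      {t | t ∈ O ∧ Finsupp.weight W t ≤ Finsupp.weight W s}).map (LinearMap.mulLeft K (X i)) ≤
      J.restrictScalars K ⊔ restrictSupport K
        {t | t ∈ O ∧ Finsupp.weight W t ≤ Finsupp.weight W (s + Finsupp.single i 1)} := by
    rw [Submodule.map_sup]
    refine sup_le ?_ ?_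
    · rintro _ ⟨f, hf, rfl⟩
      exact Submodule.mem_sup_left (J.mul_mem_left _ hf)
    · rw [restrictSupport_eq_span K {t | t ∈ O ∧ Finsupp.weight W t ≤ Finsupp.weight W s},
        Submodule.map_span_le]
      rintro _ ⟨t, ⟨htO, hts⟩, rfl⟩
      have hw : Finsupp.weight W (t + Finsupp.single i 1) ≤
          Finsupp.weight W (s + Finsupp.single i 1) := by
        rw [map_add, map_add]; exact Nat.add_le_add_right hts _
      have hmul : LinearMap.mulLeft K (X i) (monomial t (1 : K)) =
          monomial (t + Finsupp.single i 1) 1 := by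
        rw [LinearMap.mulLeft_apply, X, monomial_mul, one_mul, add_comm]
      rw [hmul]
      rcases add_single_mem_or_mem_border htO i with h | h
      · exact Submodule.mem_sup_right ((monomial_mem_restrictSupport K).2 (Or.inl ⟨h, hw⟩))
      · exact mem_sup_restrictSupport_mono (hb _ h) fun r hr => ⟨hr.1, hr.2.trans hw⟩
  have := key (Submodule.mem_map_of_mem (ih s hlt))
  rwa [LinearMap.mulLeft_apply, X, monomial_mul, one_mul, add_comm (Finsupp.single i 1)] at this

/-- An ideal `J ≤ I` containing a border prebasis together with `⟨O⟩` spans `P`, so `J = I` by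
modularity of the lattice of subspaces. -/
lemma IsBorderBasis.eq_span {g : border O → MvPolynomial (Fin n) K} (h0 : (0 : Fin n →₀ ℕ) ∈ O)
    (hg : IsBorderBasis O g I) : I = Ideal.span (Set.range g) := by
  have hle : Ideal.span (Set.range g) ≤ I :=
    Ideal.span_le.2 (Set.range_subset_iff.2 fun b => (hg.1 b).1)
  refine le_antisymm (fun f hf => ?_) hle
  have hmem : f ∈ (Ideal.span (Set.range g)).restrictScalars K ⊔
      restrictSupport K (O : Set (Fin n →₀ ℕ)) := by
    have htop : (⊤ : Submodule K (MvPolynomial (Fin n) K)) ≤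
        (Ideal.span (Set.range g)).restrictScalars K ⊔
          restrictSupport K (O : Set (Fin n →₀ ℕ)) := by
      rw [← restrictSupport_univ, restrictSupport_eq_span, Submodule.span_le]
      rintro _ ⟨u, -, rfl⟩
      refine mem_sup_restrictSupport_mono
        (monomial_mem_sup_of_border (W := 0) h0 (fun b hb => ?_) u) fun t ht => ht.1
      rw [← add_sub_cancel (g ⟨b, hb⟩) (monomial b 1)]
      refine Submodule.add_mem_sup (Ideal.subset_span (Set.mem_range_self _)) ?_
      have hO : (O : Set (Fin n →₀ ℕ)) ⊆ {t | t ∈ O ∧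
          Finsupp.weight (0 : Fin n → ℕ) t ≤ Finsupp.weight (0 : Fin n → ℕ) b} :=
        fun t ht => ⟨ht, by simp [Finsupp.weight_apply]⟩
      exact restrictSupport_mono K hO (isBorderPrebasis_iff.1 hg.1 ⟨b, hb⟩).2
    exact htop Submodule.mem_top
  obtain ⟨s, hs, v, hv, rfl⟩ := Submodule.mem_sup.1 hmem
  have hvI : v ∈ I := (I.add_mem_iff_right (hle hs)).1 hf
  rw [Submodule.disjoint_def.1 hg.2.disjoint v hvI (by rwa [termSpan_eq_restrictSupport]),
    add_zero]
  exact hs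

/-! ### Degree forms -/

lemma coeff_degreeForm (f : MvPolynomial (Fin n) K) (u : Fin n →₀ ℕ) :
    coeff u (degreeForm W f) =
      if Finsupp.weight W u = weightedTotalDegree W f then coeff u f else 0 := by
  rw [degreeForm, coeff_weightedHomogeneousComponent]

lemma degreeForm_ne_zero {f : MvPolynomial (Fin n) K} (hf : f ≠ 0) : degreeForm W f ≠ 0 := by
  obtain ⟨u, hu, huw⟩ := Finset.exists_mem_eq_sup f.support (support_nonempty.2 hf)
    (fun s => Finsupp.weight W s)
  refine ne_zero_iff.2 ⟨u, ?_⟩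
  rw [coeff_degreeForm, weightedTotalDegree, if_pos huw.symm]
  exact mem_support_iff.1 hu

lemma weightedTotalDegree_eq_of_mem_support_degreeForm {f : MvPolynomial (Fin n) K}
    {u : Fin n →₀ ℕ} (hu : u ∈ (degreeForm W f).support) :
    weightedTotalDegree W f = Finsupp.weight W u := by
  rw [mem_support_iff, coeff_degreeForm] at hu
  by_contra h
  exact hu (if_neg (Ne.symm h))

lemma degreeForm_mem_degreeFormIdeal {f : MvPolynomial (Fin n) K} (hf : f ∈ I) :
    degreeForm W f ∈ degreeFormIdeal W I := by
  rcases eq_or_ne f 0 with rfl | h0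
  · rw [degreeForm, map_zero]
    exact Ideal.zero_mem _
  · exact Ideal.subset_span ⟨f, hf, h0, rfl⟩

lemma weightedHomogeneousComponent_mem_restrictSupport {s : Set (Fin n →₀ ℕ)}
    {p : MvPolynomial (Fin n) K} (hp : p ∈ restrictSupport K s) (d : ℕ) :
    weightedHomogeneousComponent W d p ∈
      restrictSupport K {t | t ∈ s ∧ Finsupp.weight W t = d} := by
  rw [mem_restrictSupport_iff_coeff] at hp ⊢
  intro u hu
  rw [coeff_weightedHomogeneousComponent] at hu
  split_ifs at hu with h
  · exact ⟨hp u hu, h⟩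
  · exact absurd rfl hu

lemma sub_weightedHomogeneousComponent_mem {d : ℕ} {p : MvPolynomial (Fin n) K}
    (hp : p ∈ restrictSupport K {u | Finsupp.weight W u ≤ d}) :
    p - weightedHomogeneousComponent W d p ∈ restrictSupport K {u | Finsupp.weight W u < d} := by
  rw [mem_restrictSupport_iff_coeff] at hp ⊢
  intro u hu
  rw [coeff_sub, coeff_weightedHomogeneousComponent] at hu
  split_ifs at hu with h
  · exact absurd (sub_self _) hu
  · rw [sub_zero] at hu
    exact lt_of_le_of_ne (hp u hu) h

lemma weightedTotalDegree_le_of_mem {d : ℕ} {p : MvPolynomial (Fin n) K}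
    (hp : p ∈ restrictSupport K {u | Finsupp.weight W u ≤ d}) : weightedTotalDegree W p ≤ d :=
  Finset.sup_le fun _ hu => hp hu

lemma weightedHomogeneousComponent_mem_degreeFormIdeal {d : ℕ} {f : MvPolynomial (Fin n) K}
    (hf : f ∈ I) (hd : f ∈ restrictSupport K {u | Finsupp.weight W u ≤ d}) :
    weightedHomogeneousComponent W d f ∈ degreeFormIdeal W I := by
  rcases (weightedTotalDegree_le_of_mem hd).lt_or_eq with h | h
  · rw [weightedHomogeneousComponent_eq_zero d f h]
    exact Ideal.zero_mem _
  · rw [← h]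
    exact degreeForm_mem_degreeFormIdeal hf

lemma weightedHomogeneousComponent_monomial_mul (u : Fin n →₀ ℕ) (c : K)
    (p : MvPolynomial (Fin n) K) (d : ℕ) :
    weightedHomogeneousComponent W d (monomial u c * p) =
      if Finsupp.weight W u ≤ d then
        monomial u c * weightedHomogeneousComponent W (d - Finsupp.weight W u) p else 0 := by
  ext v
  rw [coeff_weightedHomogeneousComponent, coeff_monomial_mul']
  by_cases huv : u ≤ v
  · obtain ⟨s, rfl⟩ := exists_add_of_le huv
    have hw : Finsupp.weight W (u + s) = Finsupp.weight W u + Finsupp.weight W s := map_add _ _ _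
    by_cases hd : Finsupp.weight W u ≤ d
    · rw [if_pos hd, coeff_monomial_mul', coeff_weightedHomogeneousComponent, add_tsub_cancel_left,
        hw]
      split_ifs <;> first | rfl | omega | simp
    · rw [if_neg hd, if_neg (by omega), coeff_zero]
  · rw [if_neg huv, ite_self]
    split_ifs
    · rw [coeff_monomial_mul', if_neg huv]
    · rw [coeff_zero]

/-- Every homogeneous component of an element of `DF_W(I)` is the leading part of a single element
of `I`, of degree at most that of the component. -/
lemma exists_weightedHomogeneousComponent_eq {p : MvPolynomial (Fin n) K}
    (hp : p ∈ degreeFormIdeal W I) (d : ℕ) :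
    ∃ f ∈ I, f ∈ restrictSupport K {u | Finsupp.weight W u ≤ d} ∧
      weightedHomogeneousComponent W d f = weightedHomogeneousComponent W d p := by
  induction hp using Submodule.span_induction generalizing d with
  | zero => exact ⟨0, I.zero_mem, Submodule.zero_mem _, rfl⟩
  | add x y _ _ hx hy =>
    obtain ⟨f, hf, hfd, hfx⟩ := hx d
    obtain ⟨g, hg, hgd, hgy⟩ := hy d
    exact ⟨f + g, I.add_mem hf hg, Submodule.add_mem _ hfd hgd, by rw [map_add, map_add, hfx, hgy]⟩
  | mem x hx =>
    obtain ⟨f, hf, -, rfl⟩ := hx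
    by_cases hd : weightedTotalDegree W f = d
    · refine ⟨f, hf, fun u hu => hd ▸ le_weightedTotalDegree W hu, ?_⟩
      rw [degreeForm, hd]
      ext u
      simp only [coeff_weightedHomogeneousComponent]
      split_ifs <;> rfl
    · refine ⟨0, I.zero_mem, Submodule.zero_mem _, ?_⟩
      rw [map_zero, degreeForm]
      exact ((weightedHomogeneousComponent_isWeightedHomogeneous _
        f).weightedHomogeneousComponent_ne d (Ne.symm hd)).symm
  | smul a x _ hx =>
    induction a using MvPolynomial.induction_on' generalizing d with
    | add a b ha hb =>
      obtain ⟨f, hf, hfd, hfx⟩ := ha d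
      obtain ⟨g, hg, hgd, hgy⟩ := hb d
      exact ⟨f + g, I.add_mem hf hg, Submodule.add_mem _ hfd hgd, by
        rw [add_smul, map_add, map_add, hfx, hgy]⟩
    | monomial u c =>
      simp only [smul_eq_mul]
      by_cases hd : Finsupp.weight W u ≤ d
      · obtain ⟨f, hf, hfd, hfx⟩ := hx (d - Finsupp.weight W u)
        refine ⟨monomial u c * f, I.mul_mem_left _ hf, ?_, ?_⟩
        · rw [mem_restrictSupport_iff_coeff] at hfd ⊢
          intro v hv
          rw [coeff_monomial_mul'] at hv
          split_ifs at hv with huv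
          · obtain ⟨s, rfl⟩ := exists_add_of_le huv
            rw [add_tsub_cancel_left] at hv
            have := hfd s (right_ne_zero_of_mul hv)
            simp only [Set.mem_ofPred_eq, map_add] at this ⊢
            omega
          · exact absurd rfl hv
        · rw [weightedHomogeneousComponent_monomial_mul, weightedHomogeneousComponent_monomial_mul,
            if_pos hd, if_pos hd, hfx]
      · refine ⟨0, I.zero_mem, Submodule.zero_mem _, ?_⟩
        rw [map_zero, weightedHomogeneousComponent_monomial_mul, if_neg hd]

/-! ### Complements compatible with the degree filtration -/

/-- `⟨O⟩` is a complement of `I` compatible with the filtration of `P` by `W`-degree: besides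
`I ∩ ⟨O⟩ = 0`, every polynomial of degree `< d` is congruent modulo `I` to an element of `⟨O⟩` of
degree `< d`.  The strict inequality makes the condition for `d = 0` void. -/
def IsFilteredComplement (W : Fin n → ℕ) (O : Finset (Fin n →₀ ℕ))
    (I : Ideal (MvPolynomial (Fin n) K)) : Prop :=
  Disjoint (I.restrictScalars K) (restrictSupport K (O : Set (Fin n →₀ ℕ))) ∧
    ∀ d : ℕ, restrictSupport K {u | Finsupp.weight W u < d} ≤
      I.restrictScalars K ⊔ restrictSupport K {t | t ∈ O ∧ Finsupp.weight W t < d}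

/-- A single term `u` is congruent modulo `I` to an element of `⟨O⟩`, with a difference of
degree `≤ deg u`. -/
lemma IsFilteredComplement.exists_monomial_eq_add (h : IsFilteredComplement W O I)
    (u : Fin n →₀ ℕ) : ∃ f ∈ I, ∃ v ∈ restrictSupport K (O : Set (Fin n →₀ ℕ)),
      f ∈ restrictSupport K {t | Finsupp.weight W t ≤ Finsupp.weight W u} ∧
      monomial u 1 = f + v := by
  obtain ⟨f, hf, v, hv, hfv⟩ := Submodule.mem_sup.1 (h.2 (Finsupp.weight W u + 1)
    ((monomial_mem_restrictSupport K).2 (Or.inl (Nat.lt_succ_self (Finsupp.weight W u)))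
      : monomial u (1 : K) ∈ _))
  have hv' : v ∈ restrictSupport K {t | Finsupp.weight W t ≤ Finsupp.weight W u} :=
    restrictSupport_mono K (fun t ht => Nat.lt_succ_iff.1 ht.2) hv
  refine ⟨f, hf, v, restrictSupport_mono K (fun t ht => ht.1) hv, ?_, hfv.symm⟩
  rw [eq_sub_of_add_eq hfv]
  exact Submodule.sub_mem _ ((monomial_mem_restrictSupport K).2 (Or.inl (Set.mem_ofPred.2 le_rfl))) hv'

lemma isCompl_of_forall_monomial
    (h : Disjoint (I.restrictScalars K) (restrictSupport K (O : Set (Fin n →₀ ℕ))))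
    (h' : ∀ u, monomial u (1 : K) ∈ I.restrictScalars K ⊔
      restrictSupport K (O : Set (Fin n →₀ ℕ))) :
    IsCompl (I.restrictScalars K) (restrictSupport K (O : Set (Fin n →₀ ℕ))) := by
  refine ⟨h, codisjoint_iff_le_sup.2 ?_⟩
  rw [← restrictSupport_univ, restrictSupport_eq_span, Submodule.span_le]
  rintro _ ⟨u, -, rfl⟩
  exact h' u

lemma IsFilteredComplement.isCompl (h : IsFilteredComplement W O I) :
    IsCompl (I.restrictScalars K) (restrictSupport K (O : Set (Fin n →₀ ℕ))) := by
  refine isCompl_of_forall_monomial h.1 fun u => ?_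
  obtain ⟨f, hf, v, hv, -, hfv⟩ := h.exists_monomial_eq_add u
  rw [hfv]
  exact Submodule.add_mem_sup hf hv

lemma IsFilteredComplement.isCompl_degreeFormIdeal (h : IsFilteredComplement W O I) :
    IsCompl ((degreeFormIdeal W I).restrictScalars K)
      (restrictSupport K (O : Set (Fin n →₀ ℕ))) := by
  refine isCompl_of_forall_monomial (Submodule.disjoint_def.2 fun p hp hpO => ?_) fun u => ?_
  · ext u
    obtain ⟨f, hf, hfd, hfp⟩ := exists_weightedHomogeneousComponent_eq hp (Finsupp.weight W u)
    obtain ⟨i, hi, v, hv, hiv⟩ := Submodule.mem_sup.1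
      (h.2 _ (sub_weightedHomogeneousComponent_mem hfd))
    have hmem : f - i = weightedHomogeneousComponent W (Finsupp.weight W u) p + v := by
      rw [← hfp]
      linear_combination -hiv
    -- The leading part of `f` plus the normal form of the rest of `f` lies in `I ∩ ⟨O⟩`.
    have hzero := Submodule.disjoint_def.1 h.1 (f - i) (I.sub_mem hf hi) (by
      rw [hmem]
      exact Submodule.add_mem _
        (restrictSupport_mono K (fun t ht => ht.1)
          (weightedHomogeneousComponent_mem_restrictSupport hpO _))
        (restrictSupport_mono K (fun t ht => ht.1) hv))
    have hvu : coeff u v = 0 := by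
      by_contra hne
      exact lt_irrefl _ (mem_restrictSupport_iff_coeff.1 hv u hne).2
    have := congrArg (coeff u) (hmem.symm.trans hzero)
    rwa [coeff_add, coeff_weightedHomogeneousComponent, if_pos rfl, hvu, add_zero] at this
  · obtain ⟨f, hf, v, hv, hfd, hfv⟩ := h.exists_monomial_eq_add u
    have hu : monomial u (1 : K) = weightedHomogeneousComponent W (Finsupp.weight W u) f +
        weightedHomogeneousComponent W (Finsupp.weight W u) v := by
      rw [← map_add, ← hfv]
      exact ((isWeightedHomogeneous_monomial W u 1 rfl).weightedHomogeneousComponent_same).symm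
    rw [hu]
    exact Submodule.add_mem_sup (weightedHomogeneousComponent_mem_degreeFormIdeal hf hfd)
      (restrictSupport_mono K (fun t ht => ht.1)
        (weightedHomogeneousComponent_mem_restrictSupport hv _))

/-- Splitting off leading parts one degree at a time lifts a complement of `DF_W(I)` to a filtered
complement of `I`. -/
lemma isFilteredComplement_of_isCompl (h : IsCompl ((degreeFormIdeal W I).restrictScalars K)
    (restrictSupport K (O : Set (Fin n →₀ ℕ)))) : IsFilteredComplement W O I := by
  refine ⟨Submodule.disjoint_def.2 fun f hf hfO => ?_, fun d => ?_⟩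
  · by_contra hne
    refine degreeForm_ne_zero (W := W) hne (Submodule.disjoint_def.1 h.disjoint _
      (degreeForm_mem_degreeFormIdeal hf) ?_)
    exact restrictSupport_mono K (fun t ht => ht.1)
      (weightedHomogeneousComponent_mem_restrictSupport hfO _)
  · induction d with
    | zero =>
      intro p hp
      have : p = 0 := by
        ext u
        by_contra hne
        exact Nat.not_lt_zero _ (mem_restrictSupport_iff_coeff.1 hp u hne)
      rw [this]
      exact Submodule.zero_mem _
    | succ d ih =>
      intro p hp
      simp only [Nat.lt_succ_iff] at hp ⊢
      obtain ⟨q, hq, v, hv, hqv⟩ := Submodule.mem_sup.1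
        (h.sup_eq_top ▸ Submodule.mem_top : p ∈ (degreeFormIdeal W I).restrictScalars K ⊔ _)
      obtain ⟨f, hf, hfd, hfq⟩ := exists_weightedHomogeneousComponent_eq hq d
      have hlow := ih (Submodule.sub_mem _ (sub_weightedHomogeneousComponent_mem hp)
        (sub_weightedHomogeneousComponent_mem hfd))
      have hsplit : p = (p - weightedHomogeneousComponent W d p -
          (f - weightedHomogeneousComponent W d f)) +
            (f + weightedHomogeneousComponent W d v) := by
        rw [hfq, ← hqv, map_add]
        ring
      rw [hsplit]
      refine Submodule.add_mem _
        (mem_sup_restrictSupport_mono hlow fun t ht => ⟨ht.1, ht.2.le⟩)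
        (Submodule.add_mem_sup hf ?_)
      have hsub : {t | t ∈ (O : Set (Fin n →₀ ℕ)) ∧ Finsupp.weight W t = d} ⊆
          {t | t ∈ O ∧ Finsupp.weight W t ≤ d} := fun t ht => ⟨ht.1, ht.2.le⟩
      exact restrictSupport_mono K hsub (weightedHomogeneousComponent_mem_restrictSupport hv d)

lemma IsBorderBasis.isFilteredComplement {g : border O → MvPolynomial (Fin n) K}
    (h0 : (0 : Fin n →₀ ℕ) ∈ O) (hg : IsBorderBasis O g I)
    (hdf : ∀ b, b.1 ∈ (degreeForm W (g b)).support) : IsFilteredComplement W O I := by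
  refine ⟨termSpan_eq_restrictSupport (K := K) O ▸ hg.2.disjoint, fun d => ?_⟩
  rw [restrictSupport_eq_span, Submodule.span_le]
  rintro _ ⟨u, hu, rfl⟩
  refine mem_sup_restrictSupport_mono
    (monomial_mem_sup_of_border h0 (fun b hb => ?_) u) fun t ht => ⟨ht.1, ht.2.trans_lt hu⟩
  rw [← add_sub_cancel (g ⟨b, hb⟩) (monomial b 1)]
  refine Submodule.add_mem_sup (hg.1 _).1 (mem_restrictSupport_iff_coeff.2 fun t ht => ?_)
  have htO : t ∈ O := mem_restrictSupport_iff_coeff.1 (isBorderPrebasis_iff.1 hg.1 ⟨b, hb⟩).2 t ht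
  have hne : b ≠ t := fun h => notMem_of_mem_border hb (h ▸ htO)
  rw [coeff_sub, coeff_monomial, if_neg hne, zero_sub, neg_ne_zero] at ht
  refine ⟨htO, ?_⟩
  rw [← weightedTotalDegree_eq_of_mem_support_degreeForm (hdf ⟨b, hb⟩)]
  exact le_weightedTotalDegree W (mem_support_iff.2 ht)

/-- If `b` were missing from the degree form of `g b`, that degree form would be a nonzero element
of `DF_W(I) ∩ ⟨O⟩`. -/
lemma IsBorderPrebasis.mem_support_degreeForm {g : border O → MvPolynomial (Fin n) K}
    (hg : IsBorderPrebasis O g I) (h : IsCompl ((degreeFormIdeal W I).restrictScalars K)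
      (restrictSupport K (O : Set (Fin n →₀ ℕ)))) (b : border O) :
    b.1 ∈ (degreeForm W (g b)).support := by
  by_contra hb
  have hne : g b ≠ 0 := ne_zero_iff.2 ⟨b.1, by rw [hg.coeff_self]; exact one_ne_zero⟩
  refine degreeForm_ne_zero (W := W) hne (Submodule.disjoint_def.1 h.disjoint _
    (degreeForm_mem_degreeFormIdeal (hg b).1) (mem_restrictSupport_iff_coeff.2 fun u hu => ?_))
  refine hg.mem_of_coeff_ne_zero b (u := u) (fun h0 => hu ?_) ?_
  · rw [coeff_degreeForm, h0, ite_self]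
  · rintro rfl
    exact hb (mem_support_iff.2 hu)

lemma IsBorderPrebasis.isBorderBasis_degreeForm {g : border O → MvPolynomial (Fin n) K}
    (hg : IsBorderPrebasis O g I) (h : IsCompl ((degreeFormIdeal W I).restrictScalars K)
      (restrictSupport K (O : Set (Fin n →₀ ℕ)))) :
    IsBorderBasis O (fun b => degreeForm W (g b)) (degreeFormIdeal W I) := by
  refine ⟨isBorderPrebasis_iff.2 fun b => ⟨degreeForm_mem_degreeFormIdeal (hg b).1, ?_⟩, by
    rwa [termSpan_eq_restrictSupport]⟩
  have hdeg := weightedTotalDegree_eq_of_mem_support_degreeForm (hg.mem_support_degreeForm h b)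
  have hb : monomial b.1 (1 : K) - degreeForm W (g b) =
      weightedHomogeneousComponent W (Finsupp.weight W b.1) (monomial b.1 1 - g b) := by
    rw [map_sub, degreeForm, hdeg,
      (isWeightedHomogeneous_monomial W b.1 (1 : K) rfl).weightedHomogeneousComponent_same]
  rw [hb]
  exact restrictSupport_mono K (fun t ht => ht.1)
    (weightedHomogeneousComponent_mem_restrictSupport (isBorderPrebasis_iff.1 hg b).2 _)

/-! ### Homogenization and freeness of the deformation -/

lemma aeval_rename_succ_monomial {A : Type*} [CommRing A] [Algebra K A] (a : A) (z : Fin n → A)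
    (u : Fin n →₀ ℕ) (k : K) :
    aeval (Fin.cons a fun i => a ^ W i * z i : Fin (n + 1) → A)
      (rename Fin.succ (monomial u k)) = a ^ Finsupp.weight W u * aeval z (monomial u k) := by
  have hprod : (u.prod fun i k => ((Fin.cons a fun i => a ^ W i * z i : Fin (n + 1) → A) ∘
      Fin.succ) i ^ k) = a ^ Finsupp.weight W u * u.prod fun i k => z i ^ k := by
    simp only [Function.comp_apply, Fin.cons_succ, mul_pow, Finsupp.weight_apply,
      Finsupp.sum, Finsupp.prod, ← pow_mul, ← Finset.prod_pow_eq_pow_sum, smul_eq_mul,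
      Finset.prod_mul_distrib]
    simp only [mul_comm (W _)]
  rw [aeval_rename, aeval_monomial, aeval_monomial, hprod, mul_left_comm]

/-- Evaluating `f^hom` at `x₀ = a`, `xᵢ = a ^ wᵢ zᵢ` rescales the value of `f` at `z`. -/
lemma aeval_homogenization {A : Type*} [CommRing A] [Algebra K A] (a : A) (z : Fin n → A)
    (f : MvPolynomial (Fin n) K) :
    aeval (Fin.cons a fun i => a ^ W i * z i : Fin (n + 1) → A) (homogenization W f) =
      a ^ weightedTotalDegree W f * aeval z f := by
  conv_rhs => enter [2]; rw [← support_sum_monomial_coeff f, map_sum]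
  rw [homogenization, map_sum, Finset.mul_sum]
  refine Finset.sum_congr rfl fun u hu => ?_
  rw [map_mul, map_pow, aeval_X, Fin.cons_zero, aeval_rename_succ_monomial, ← mul_assoc,
    pow_sub_mul_pow a (le_weightedTotalDegree W hu)]

/-- Evaluating `f^hom` at `x₀ = 0` leaves the degree form of `f`. -/
lemma aeval_homogenization_zero {A : Type*} [CommRing A] [Algebra K A] (z : Fin n → A)
    (f : MvPolynomial (Fin n) K) :
    aeval (Fin.cons 0 z : Fin (n + 1) → A) (homogenization W f) = aeval z (degreeForm W f) := by
  rw [homogenization, map_sum, degreeForm, weightedHomogeneousComponent_apply, map_sum,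
    Finset.sum_filter]
  refine Finset.sum_congr rfl fun u hu => ?_
  have hcomp : (Fin.cons 0 z : Fin (n + 1) → A) ∘ Fin.succ = z := by
    funext i
    simp
  rw [map_mul, map_pow, aeval_X, Fin.cons_zero, aeval_rename, hcomp]
  split_ifs with h
  · rw [h, Nat.sub_self, pow_zero, one_mul]
  · have hlt := lt_of_le_of_ne (le_weightedTotalDegree W hu) h
    rw [zero_pow (Nat.sub_ne_zero_of_lt hlt), zero_mul]

/-- The `K`-linear homogenization in the fixed degree `d`, sending a term `u` to
`x₀ ^ (d - deg u) u`.  It is meaningful on polynomials of degree `≤ d`, since the exponent is a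
truncated difference. -/
noncomputable def homogenizeTo (W : Fin n → ℕ) (d : ℕ) :
    MvPolynomial (Fin n) K →ₗ[K] MvPolynomial (Fin (n + 1)) K :=
  (basisMonomials (Fin n) K).constr K fun u =>
    X 0 ^ (d - Finsupp.weight W u) * rename Fin.succ (monomial u 1)

lemma homogenizeTo_monomial (d : ℕ) (u : Fin n →₀ ℕ) (a : K) :
    homogenizeTo W d (monomial u a) =
      X 0 ^ (d - Finsupp.weight W u) * rename Fin.succ (monomial u a) := by
  have h1 : monomial u a = a • basisMonomials (Fin n) K u := by
    rw [coe_basisMonomials, smul_monomial, smul_eq_mul, mul_one]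
  rw [h1, map_smul, homogenizeTo, Module.Basis.constr_basis, map_smul, mul_smul_comm,
    coe_basisMonomials]

lemma homogenizeTo_eq {d : ℕ} {f : MvPolynomial (Fin n) K}
    (hf : f ∈ restrictSupport K {u | Finsupp.weight W u ≤ d}) :
    homogenizeTo W d f = X 0 ^ (d - weightedTotalDegree W f) * homogenization W f := by
  conv_lhs => rw [← support_sum_monomial_coeff f, map_sum]
  rw [homogenization, Finset.mul_sum]
  refine Finset.sum_congr rfl fun u hu => ?_
  rw [homogenizeTo_monomial, ← mul_assoc, ← pow_add]
  have h1 := le_weightedTotalDegree W hu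
  have h2 := weightedTotalDegree_le_of_mem hf
  congr 2
  omega

lemma homogenizeTo_mem_homIdeal {d : ℕ} {f : MvPolynomial (Fin n) K} (hfI : f ∈ I)
    (hf : f ∈ restrictSupport K {u | Finsupp.weight W u ≤ d}) :
    homogenizeTo W d f ∈ homIdeal W I := by
  rw [homogenizeTo_eq hf]
  exact Ideal.mul_mem_left _ _ (Ideal.subset_span ⟨f, hfI, rfl⟩)

/-- The target of a ring homomorphism is free, hence flat, once it has a finite basis. -/
lemma isFreeHom_and_flat_of_basis {R S ι : Type*} [CommRing R] [CommRing S] [Fintype ι]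
    (φ : R →+* S) (t : ι → S)
    (hli : ∀ c : ι → R, ∑ i, φ (c i) * t i = 0 → ∀ i, c i = 0)
    (hspan : ∀ s : S, ∃ c : ι → R, s = ∑ i, φ (c i) * t i) :
    IsFreeHom φ ∧ φ.Flat := by
  algebraize [φ]
  have hli' : LinearIndependent R t := Fintype.linearIndependent_iff.2 fun c hc => by
    simp only [Algebra.smul_def] at hc
    exact hli c hc
  have hspan' : ⊤ ≤ Submodule.span R (Set.range t) := fun s _ => by
    obtain ⟨c, hc⟩ := hspan s
    refine (Submodule.mem_span_range_iff_exists_fun R).2 ⟨c, ?_⟩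
    simp only [Algebra.smul_def]
    exact hc.symm
  have hfree : Module.Free R S := Module.Free.of_basis (Module.Basis.mk hli' hspan')
  exact ⟨hfree, (inferInstance : Module.Flat R S)⟩

/-- Modulo `I^hom`, the terms of `O` span over `K[x₀]`: homogenizing a congruence
`u ≡ v mod I` with `deg v ≤ deg u` gives one in the homogenized ring. -/
lemma IsFilteredComplement.exists_sum_sub_mem_homIdeal (h : IsFilteredComplement W O I)
    (F : MvPolynomial (Fin (n + 1)) K) : ∃ c : O → Polynomial K,
      F - ∑ t : O, Polynomial.aeval (X 0) (c t) * rename Fin.succ (monomial t.1 1) ∈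
        homIdeal W I := by
  induction F using MvPolynomial.induction_on' with
  | add F G hF hG =>
    obtain ⟨c, hc⟩ := hF
    obtain ⟨e, he⟩ := hG
    refine ⟨c + e, ?_⟩
    simp only [Pi.add_apply, map_add, add_mul, Finset.sum_add_distrib]
    rw [add_sub_add_comm]
    exact Ideal.add_mem _ hc he
  | monomial m a =>
    obtain ⟨f, hf, v, hv, hfd, hfv⟩ := h.exists_monomial_eq_add m.tail
    set d := Finsupp.weight W m.tail
    have hexp : m = Finsupp.single 0 (m 0) + Finsupp.mapDomain Fin.succ m.tail := by
      refine Finsupp.ext fun i => Fin.cases ?_ (fun j => ?_) i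
      · rw [Finsupp.add_apply, Finsupp.single_eq_same, Finsupp.mapDomain_of_notMem_range, add_zero]
        rintro ⟨j, hj⟩
        exact Fin.succ_ne_zero j hj
      · rw [Finsupp.add_apply, Finsupp.mapDomain_apply (Fin.succ_injective n),
          Finsupp.single_eq_of_ne (Fin.succ_ne_zero j), zero_add, Finsupp.tail_apply]
    have hm : monomial m a = C a * X 0 ^ m 0 * homogenizeTo W d (monomial m.tail 1) := by
      rw [homogenizeTo_monomial, Nat.sub_self, pow_zero, one_mul, rename_monomial,
        X_pow_eq_monomial, C_mul_monomial, monomial_mul, mul_one, mul_one]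
      rw [← hexp]
    have hvsum : homogenizeTo W d v = ∑ t : O, Polynomial.aeval (X 0)
        (Polynomial.monomial (d - Finsupp.weight W t.1) (coeff t.1 v)) *
          rename Fin.succ (monomial t.1 1) := by
      conv_lhs => rw [eq_sum_of_mem_restrictSupport hv, map_sum, ← Finset.sum_coe_sort]
      refine Finset.sum_congr rfl fun t _ => ?_
      rw [homogenizeTo_monomial, Polynomial.aeval_monomial, rename_monomial, rename_monomial,
        algebraMap_eq, mul_right_comm, C_mul_monomial, mul_one, mul_comm]
    refine ⟨fun t => Polynomial.C a * Polynomial.X ^ m 0 *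
      Polynomial.monomial (d - Finsupp.weight W t.1) (coeff t.1 v), ?_⟩
    have hsum : ∑ t : O, Polynomial.aeval (X 0 : MvPolynomial (Fin (n + 1)) K)
        (Polynomial.C a * Polynomial.X ^ m 0 *
          Polynomial.monomial (d - Finsupp.weight W t.1) (coeff t.1 v)) *
          rename Fin.succ (monomial t.1 1) = C a * X 0 ^ m 0 * homogenizeTo W d v := by
      rw [hvsum, Finset.mul_sum]
      refine Finset.sum_congr rfl fun t _ => ?_
      rw [map_mul, map_mul, map_pow, Polynomial.aeval_C, Polynomial.aeval_X, algebraMap_eq,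
        mul_assoc]
    rw [hsum, hm, hfv, map_add, mul_add, add_sub_cancel_right]
    exact Ideal.mul_mem_left _ _ (homogenizeTo_mem_homIdeal hf hfd)

/-- The terms of `O` are independent over `K[x₀]` modulo `I^hom`.  The substitution `x₀ ↦ X`,
`xᵢ ↦ X ^ wᵢ xᵢ` maps `I^hom` into `I[X]`, whose elements are compared with `⟨O⟩` coefficient by
coefficient. -/
lemma eq_zero_of_sum_mem_homIdeal
    (h : Disjoint (I.restrictScalars K) (restrictSupport K (O : Set (Fin n →₀ ℕ))))
    {c : O → Polynomial K}
    (hc : ∑ t : O, Polynomial.aeval (X 0) (c t) * rename Fin.succ (monomial t.1 1) ∈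
      homIdeal W I) (t : O) : c t = 0 := by
  let z : Fin n → Polynomial (MvPolynomial (Fin n) K) := fun i => Polynomial.C (X i)
  let φ : MvPolynomial (Fin (n + 1)) K →ₐ[K] Polynomial (MvPolynomial (Fin n) K) :=
    aeval (Fin.cons Polynomial.X fun i => Polynomial.X ^ W i * z i)
  have hz : ∀ f : MvPolynomial (Fin n) K, aeval z f = Polynomial.C f := fun f => by
    have : aeval z = (Polynomial.CAlgHom : _ →ₐ[K] Polynomial (MvPolynomial (Fin n) K)) :=
      MvPolynomial.algHom_ext fun i => aeval_X _ _
    rw [this]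
    rfl
  have hφ : ∀ F ∈ homIdeal W I, φ F ∈ I.map (Polynomial.C : _ →+* Polynomial _) := by
    intro F hF
    have hle : homIdeal W I ≤ (I.map (Polynomial.C : _ →+* Polynomial _)).comap φ := by
      refine Ideal.span_le.2 ?_
      rintro _ ⟨f, hf, rfl⟩
      rw [SetLike.mem_coe, Ideal.mem_comap, aeval_homogenization, hz]
      exact Ideal.mul_mem_left _ _ (Ideal.mem_map_of_mem _ hf)
    exact hle hF
  have hterm : ∀ s : O, φ (Polynomial.aeval (X 0) (c s) * rename Fin.succ (monomial s.1 1)) =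
      (c s).map C * Polynomial.X ^ Finsupp.weight W s.1 * Polynomial.C (monomial s.1 1) := fun s => by
    rw [map_mul, ← Polynomial.aeval_algHom_apply, aeval_rename_succ_monomial, hz, aeval_X,
      Fin.cons_zero, ← mul_assoc]
    rfl
  ext k
  have hmem := Ideal.mem_map_C_iff.1 (hφ _ hc) (k + Finsupp.weight W t.1)
  rw [map_sum, Polynomial.finsetSum_coeff] at hmem
  simp only [hterm, Polynomial.coeff_mul_C, Polynomial.coeff_mul_X_pow', Polynomial.coeff_map]
    at hmem
  have hzero := Submodule.disjoint_def.1 h _ hmem (Submodule.sum_mem _ fun s _ => by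
    split_ifs
    · rw [C_mul_monomial]
      exact (monomial_mem_restrictSupport K).2 (Or.inl s.2)
    · rw [zero_mul]
      exact Submodule.zero_mem _)
  have hcoeff := congrArg (coeff t.1) hzero
  rw [coeff_sum, Finset.sum_eq_single t] at hcoeff
  · simpa using hcoeff
  · intro s _ hst
    split_ifs
    · rw [C_mul_monomial, coeff_monomial, if_neg (mt Subtype.ext hst)]
    · rw [zero_mul, coeff_zero]
  · exact fun ht => absurd (Finset.mem_univ t) ht

lemma IsFilteredComplement.isFreeHom_and_flat_deformation (h : IsFilteredComplement W O I) :
    IsFreeHom (deformation W I).toRingHom ∧ (deformation W I).toRingHom.Flat := by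
  have hmk : ∀ c : O → Polynomial K, ∑ t : O, (deformation W I).toRingHom (c t) *
      Ideal.Quotient.mk (homIdeal W I) (rename Fin.succ (monomial t.1 1)) =
      Ideal.Quotient.mk (homIdeal W I)
        (∑ t : O, Polynomial.aeval (X 0) (c t) * rename Fin.succ (monomial t.1 1)) := by
    intro c
    rw [map_sum]
    refine Finset.sum_congr rfl fun t _ => ?_
    rw [map_mul]
    rfl
  refine isFreeHom_and_flat_of_basis _ (fun t : O =>
    Ideal.Quotient.mk (homIdeal W I) (rename Fin.succ (monomial t.1 1))) ?_ ?_
  · intro c hc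
    rw [hmk, Ideal.Quotient.eq_zero_iff_mem] at hc
    exact eq_zero_of_sum_mem_homIdeal h.1 hc
  · intro s
    obtain ⟨F, rfl⟩ := Ideal.Quotient.mk_surjective s
    obtain ⟨c, hc⟩ := h.exists_sum_sub_mem_homIdeal F
    refine ⟨c, ?_⟩
    rw [hmk, Ideal.Quotient.mk_eq_mk_iff_sub_mem]
    exact hc

/-! ### Fibers of the deformation -/

/-- A `K`-algebra homomorphism out of the fiber over `c` is given by a point with `x₀ = c` at which
all `f^hom` with `f ∈ I` vanish. -/
noncomputable def fiberLift {A : Type*} [CommRing A] [Algebra K A] (c : K) (y : Fin n → A)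
    (h : ∀ f ∈ I, aeval (Fin.cons (algebraMap K A c) y : Fin (n + 1) → A)
      (homogenization W f) = 0) : Fiber W I c →ₐ[K] A :=
  Ideal.Quotient.liftₐ _ (aeval (Fin.cons (algebraMap K A c) y)) fun F hF => by
    have hle : homIdeal W I ⊔ Ideal.span {(X 0 - C c : MvPolynomial (Fin (n + 1)) K)} ≤
        RingHom.ker (aeval (Fin.cons (algebraMap K A c) y : Fin (n + 1) → A)) := by
      refine sup_le (Ideal.span_le.2 ?_) ((Ideal.span_singleton_le_iff_mem _).2 ?_)
      · rintro _ ⟨f, hf, rfl⟩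
        exact h f hf
      · rw [RingHom.mem_ker, map_sub, aeval_X, aeval_C, Fin.cons_zero, sub_self]
    exact RingHom.mem_ker.1 (hle hF)

/-- The class of `xᵢ₊₁` in the fiber over `c`. -/
noncomputable def fiberX (W : Fin n → ℕ) (I : Ideal (MvPolynomial (Fin n) K)) (c : K) (i : Fin n) :
    Fiber W I c :=
  Ideal.Quotient.mk _ (X i.succ)

lemma fiberLift_fiberX {A : Type*} [CommRing A] [Algebra K A] {c : K} {y : Fin n → A}
    (h : ∀ f ∈ I, aeval (Fin.cons (algebraMap K A c) y : Fin (n + 1) → A)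
      (homogenization W f) = 0) (i : Fin n) : fiberLift c y h (fiberX W I c i) = y i := by
  change aeval _ (X i.succ) = y i
  rw [aeval_X, Fin.cons_succ]

lemma fiber_mk_X_zero (c : K) : (Ideal.Quotient.mk _ (X 0) : Fiber W I c) =
    algebraMap K (Fiber W I c) c :=
  Ideal.Quotient.eq.2 (Ideal.mem_sup_right (Ideal.mem_span_singleton_self _))

lemma aeval_fiberX_homogenization {c : K} {a : Fiber W I c} (ha : a = algebraMap K _ c)
    {f : MvPolynomial (Fin n) K} (hf : f ∈ I) :
    aeval (Fin.cons a (fiberX W I c) : Fin (n + 1) → Fiber W I c)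
      (homogenization W f) = 0 := by
  have hmk : aeval (Fin.cons a (fiberX W I c)) =
      Ideal.Quotient.mkₐ K
        (homIdeal W I ⊔ Ideal.span {(X 0 - C c : MvPolynomial (Fin (n + 1)) K)}) := by
    refine MvPolynomial.algHom_ext fun i => ?_
    rw [aeval_X]
    refine Fin.cases ?_ (fun j => ?_) i
    · exact ha.trans (fiber_mk_X_zero c).symm
    · rfl
  rw [hmk]
  exact Ideal.Quotient.eq_zero_iff_mem.2
    (Ideal.mem_sup_left (Ideal.subset_span ⟨f, hf, rfl⟩))

lemma fiber_algHom_ext {A : Type*} [CommRing A] [Algebra K A] {c : K}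
    {φ ψ : Fiber W I c →ₐ[K] A} (h : ∀ i, φ (fiberX W I c i) = ψ (fiberX W I c i)) : φ = ψ := by
  refine Ideal.Quotient.algHom_ext _ (MvPolynomial.algHom_ext fun i => ?_)
  refine Fin.cases ?_ h i
  simp only [AlgHom.comp_apply, Ideal.Quotient.mkₐ_eq_mk, fiber_mk_X_zero, AlgHom.commutes]

/-- The fiber over `c ≠ 0` is `P / I`, through the rescaling `xᵢ ↦ c ^ wᵢ xᵢ`. -/
lemma nonempty_fiber_algEquiv (W : Fin n → ℕ) (I : Ideal (MvPolynomial (Fin n) K)) {c : K}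
    (hc : c ≠ 0) : Nonempty (Fiber W I c ≃ₐ[K] (MvPolynomial (Fin n) K ⧸ I)) := by
  let y : Fin n → MvPolynomial (Fin n) K ⧸ I := fun i => Ideal.Quotient.mk I (X i)
  let z : Fin n → Fiber W I c := fun i => algebraMap K _ (c⁻¹ ^ W i) * fiberX W I c i
  have hy : ∀ f ∈ I, aeval (Fin.cons (algebraMap K _ c) fun i => algebraMap K _ c ^ W i * y i)
      (homogenization W f) = 0 := fun f hf => by
    have hmk : aeval y = Ideal.Quotient.mkₐ K I :=
      MvPolynomial.algHom_ext fun i => aeval_X _ _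
    rw [aeval_homogenization, hmk, Ideal.Quotient.mkₐ_eq_mk,
      Ideal.Quotient.eq_zero_iff_mem.2 hf, mul_zero]
  have hz : ∀ f ∈ I, aeval z f = 0 := fun f hf => by
    have hX : fiberX W I c = fun i => algebraMap K _ c ^ W i * z i := by
      funext i
      rw [← mul_assoc, ← map_pow, ← map_mul, ← mul_pow, mul_inv_cancel₀ hc, one_pow, map_one,
        one_mul]
    have h0 := aeval_fiberX_homogenization (W := W) (c := c) rfl hf
    rw [hX, aeval_homogenization] at h0
    exact (((IsUnit.mk0 c hc).map (algebraMap K _)).pow _).mul_right_eq_zero.1 h0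
  refine ⟨AlgEquiv.ofAlgHom (fiberLift c _ hy) (Ideal.Quotient.liftₐ I (aeval z) hz) ?_ ?_⟩
  · refine Ideal.Quotient.algHom_ext _ (MvPolynomial.algHom_ext fun i => ?_)
    change fiberLift c _ hy (aeval z (X i)) = y i
    rw [aeval_X, map_mul, AlgHom.commutes, fiberLift_fiberX, ← mul_assoc, ← map_pow, ← map_mul,
      ← mul_pow, inv_mul_cancel₀ hc, one_pow, map_one, one_mul]
  · refine fiber_algHom_ext fun i => ?_
    rw [AlgHom.comp_apply, fiberLift_fiberX, map_mul, map_pow, AlgHom.commutes]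
    change _ * aeval z (X i) = fiberX W I c i
    rw [aeval_X, ← mul_assoc, ← map_pow, ← map_mul, ← mul_pow, mul_inv_cancel₀ hc, one_pow,
      map_one, one_mul]

/-- Setting `x₀ = 0` turns `f^hom` into `DF_W(f)`, so the special fiber is `P / DF_W(I)`. -/
lemma nonempty_fiber_zero_algEquiv (W : Fin n → ℕ) (I : Ideal (MvPolynomial (Fin n) K)) :
    Nonempty (Fiber W I 0 ≃ₐ[K] (MvPolynomial (Fin n) K ⧸ degreeFormIdeal W I)) := by
  let y : Fin n → MvPolynomial (Fin n) K ⧸ degreeFormIdeal W I :=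
    fun i => Ideal.Quotient.mk _ (X i)
  have hy : ∀ f ∈ I, aeval (Fin.cons (algebraMap K _ (0 : K)) y)
      (homogenization W f) = 0 := fun f hf => by
    have hmk : aeval y = Ideal.Quotient.mkₐ K (degreeFormIdeal W I) :=
      MvPolynomial.algHom_ext fun i => aeval_X _ _
    rw [map_zero, aeval_homogenization_zero, hmk, Ideal.Quotient.mkₐ_eq_mk,
      Ideal.Quotient.eq_zero_iff_mem.2 (degreeForm_mem_degreeFormIdeal hf)]
  have hz : ∀ f ∈ degreeFormIdeal W I, aeval (fiberX W I 0) f = 0 := by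
    have hle : degreeFormIdeal W I ≤ RingHom.ker (aeval (fiberX W I 0)) := by
      refine Ideal.span_le.2 ?_
      rintro _ ⟨f, hf, -, rfl⟩
      have h0 := aeval_fiberX_homogenization (W := W) (map_zero (algebraMap K (Fiber W I 0))).symm hf
      rwa [aeval_homogenization_zero] at h0
    exact fun f hf => hle hf
  refine ⟨AlgEquiv.ofAlgHom (fiberLift 0 y hy)
    (Ideal.Quotient.liftₐ _ (aeval (fiberX W I 0)) hz) ?_ ?_⟩
  · refine Ideal.Quotient.algHom_ext _ (MvPolynomial.algHom_ext fun i => ?_)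
    change fiberLift 0 y hy (aeval (fiberX W I 0) (X i)) = y i
    rw [aeval_X, fiberLift_fiberX]
  · refine fiber_algHom_ext fun i => ?_
    rw [AlgHom.comp_apply, fiberLift_fiberX]
    exact aeval_X _ _

end BorderBasis

theorem theorem2p3 {n : ℕ} {K : Type*} [Field K] (W : Fin n → ℕ) (hW : ∀ i, 0 < W i)
    (I : Ideal (MvPolynomial (Fin n) K)) (hI : BorderBasis.IsZeroDimensional I)
    (O : Finset (Fin n →₀ ℕ)) (hO : BorderBasis.IsOrderIdeal O) :
    ((∃ g : BorderBasis.border O → MvPolynomial (Fin n) K,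
        BorderBasis.IsBorderBasis O g I ∧
          ∀ b, b.1 ∈ (BorderBasis.degreeForm W (g b)).support) ↔
      ∃ h : BorderBasis.border O → MvPolynomial (Fin n) K,
        BorderBasis.IsBorderBasis O h (BorderBasis.degreeFormIdeal W I)) ∧
    ((∃ h : BorderBasis.border O → MvPolynomial (Fin n) K,
        BorderBasis.IsBorderBasis O h (BorderBasis.degreeFormIdeal W I)) →
      ∀ g : BorderBasis.border O → MvPolynomial (Fin n) K,
        BorderBasis.IsBorderBasis O g I →
        (∀ h : BorderBasis.border O → MvPolynomial (Fin n) K,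
          BorderBasis.IsBorderBasis O h (BorderBasis.degreeFormIdeal W I) ↔
            h = fun b => BorderBasis.degreeForm W (g b)) ∧
        I = Ideal.span (Set.range g) ∧
        BorderBasis.degreeFormIdeal W I =
          Ideal.span (Set.range fun b => BorderBasis.degreeForm W (g b)) ∧
        (BorderBasis.deformation W I).toRingHom.Flat ∧
        BorderBasis.IsFreeHom (BorderBasis.deformation W I).toRingHom ∧
        (∀ c : K, c ≠ 0 →
          Nonempty (BorderBasis.Fiber W I c ≃ₐ[K] (MvPolynomial (Fin n) K ⧸ I))) ∧
        Nonempty (BorderBasis.Fiber W I 0 ≃ₐ[K]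
          (MvPolynomial (Fin n) K ⧸ BorderBasis.degreeFormIdeal W I))) := by
  open BorderBasis in
  refine ⟨⟨?_, fun hb => ?_⟩, fun hb g hg => ?_⟩
  · rintro ⟨g, hg, hdf⟩
    have h0 := hO.zero_mem hI.1 (exists_isBorderBasis_iff.1 ⟨g, hg⟩)
    exact exists_isBorderBasis_iff.2 (hg.isFilteredComplement h0 hdf).isCompl_degreeFormIdeal
  · have hcompl := exists_isBorderBasis_iff.1 hb
    obtain ⟨g, hg⟩ := exists_isBorderBasis_iff.2
      (isFilteredComplement_of_isCompl hcompl).isCompl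
    exact ⟨g, hg, hg.1.mem_support_degreeForm hcompl⟩
  · have hcompl := exists_isBorderBasis_iff.1 hb
    have hfil := isFilteredComplement_of_isCompl hcompl
    have h0 := hO.zero_mem hI.1 hfil.isCompl
    have hdg := hg.1.isBorderBasis_degreeForm hcompl
    exact ⟨fun h => ⟨fun hh => hdg.unique hh, fun hh => hh ▸ hdg⟩, hg.eq_span h0, hdg.eq_span h0,
      hfil.isFreeHom_and_flat_deformation.2, hfil.isFreeHom_and_flat_deformation.1,
      fun c hc => nonempty_fiber_algEquiv W I hc, nonempty_fiber_zero_algEquiv W I⟩
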